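/- All quantum systems are finite-dimensional. Let $\theta$ be a register with orthonormal basis $\{|\alpha\rangle\}$ labelled by the basis labels $\alpha$, and let $A,B,E$ be further systems. For every basis label $\alpha$ let $\{F_A^{\alpha,y}\}_{y\in\mathcal Y}$ be a general measurement on $A$ with outcomes in a finite set $\mathcal Y$, i.e. operators on $A$ with $\sum_{y}(F_A^{\alpha,y})^\dagger F_A^{\alpha,y}=\mathbb I_A$. For a map $v$ on the basis labels let $\mathcal M_{v(\theta)A\to Y}$ be the measurement map $$\mathcal M_{v(\theta)A\to Y}(\rho)=\operatorname{Tr}_A\Big[\sum_{\alpha,y}|y\rangle_Y\big(|\alpha\rangle\langle\alpha|_\theta\otimes F_A^{v(\alpha),y}\big)\,\rho\,\big(|\alpha\rangle\langle\alpha|_\theta\otimes F_A^{v(\alpha),y}\big)^\dagger\langle y|_Y\Big],$$ and write $\mathcal M_{\theta A\to Y}$ when $v$ is the identity. For a positive semidefinite operator $\rho_{AB}$ let $H_{\min}(A|B)_\rho=\sup\{\lambda\in\mathbb R:\ \rho_{AB}\le 2^{-\lambda}\,\mathbb I_A\otimes\sigma_B\text{ for some state }\sigma_B\}$, and let $H_{\max}(A|B)_\rho=-H_{\min}(A|C)_\rho$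 where $\rho_{ABC}$ is a purification of $\rho_{AB}$. For $\varepsilon\ge 0$ let $H^\varepsilon_{\min}(A|B)_\rho$ be the supremum of $H_{\min}(A|B)_{\rho'}$, and $H^\varepsilon_{\max}(A|B)_\rho$ the infimum of $H_{\max}(A|B)_{\rho'}$, over all $\rho'\ge 0$ with $\operatorname{Tr}\rho'\le 1$ and $P(\rho,\rho')\le\varepsilon$, where $P$ is the purified distance $$P(\rho,\rho')=\sqrt{1-\Big(\|\sqrt{\rho}\sqrt{\rho'}\|_1+\sqrt{(1-\operatorname{Tr}\rho)(1-\operatorname{Tr}\rho')}\Big)^2}.$$ These entropies take values in $[-\infty,+\infty]$. **Theorem.** Let $\rho_{\theta ABE}$ be a quantum state (positive semidefinite of trace $1$), let $v$ be a bijection on the basis labels, and let $\varepsilon\ge 0$. Then $$H_{\min}^{\varepsilon}(Y|\theta E)_{\mathcal M_{\theta A\to Y}(\rho_{\theta ABE})}\ \ge\ q-H_{\max}^{\varepsilon}(\tilde Y|\theta B)_{\mathcal M_{v(\theta)A\to\tilde Y}(\rho_{\theta ABE})},$$ where $q=\log_2\frac1{c_q}$ and $c_q=\max_{\alpha}\max_{y,\tilde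 y}\big\|F_A^{\alpha,y}(F_A^{v(\alpha),\tilde y})^\dagger\big\|_\infty^2$, with $\|\cdot\|_\infty$ the operator norm. (The two entropies are evaluated on the reductions of the post-measurement states to $Y\theta E$ and $\tilde Y\theta B$ respectively.) -/

import Mathlib

/-!
Finite-dimensional quantum systems. A system with orthonormal basis indexed by a finite type `a`
has state space `ℂ^a`; operators on it are matrices `Matrix a a ℂ`; a composite system has the
product of the index types as its index type. Smooth entropies take values in `EReal`.
-/

noncomputable section

namespace QEntropy

open scoped Matrix Kronecker ComplexOrder MatrixOrder

/-- A quantum state: a density matrix, positive semidefinite of trace one. -/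
def IsState {a : Type*} [Fintype a] (ρ : Matrix a a ℂ) : Prop :=
  ρ.PosSemidef ∧ ρ.trace = 1

/-- A sub-normalised state: positive semidefinite of trace at most one. -/
def IsSubState {a : Type*} [Fintype a] (ρ : Matrix a a ℂ) : Prop :=
  ρ.PosSemidef ∧ ρ.trace.re ≤ 1

/-- The operator norm (largest singular value) of a matrix, for the Euclidean norm on vectors. -/
def opNorm {a : Type*} [Fintype a] [DecidableEq a] (X : Matrix a a ℂ) : ℝ :=
  ‖Matrix.toEuclideanCLM (n := a) (𝕜 := ℂ) X‖

/-- The trace norm `‖X‖₁ = Tr √(X† X)`. -/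
def traceNorm {a : Type*} [Fintype a] [DecidableEq a] (X : Matrix a a ℂ) : ℝ :=
  (CFC.sqrt (Xᴴ * X)).trace.re

/-- The generalised fidelity of sub-normalised states,
`(‖√ρ √σ‖₁ + √((1 - Tr ρ) (1 - Tr σ)))²`. -/
def fidelity {a : Type*} [Fintype a] [DecidableEq a] (ρ σ : Matrix a a ℂ) : ℝ :=
  (traceNorm (CFC.sqrt ρ * CFC.sqrt σ) +
    Real.sqrt ((1 - ρ.trace.re) * (1 - σ.trace.re))) ^ 2

/-- The purified distance of sub-normalised states. -/
def purifiedDistance {a : Type*} [Fintype a] [DecidableEq a] (ρ σ : Matrix a a ℂ) : ℝ :=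
  Real.sqrt (1 - fidelity ρ σ)

/-- Partial trace over the second of three systems. -/
def traceSecond {a b c : Type*} [Fintype b] (M : Matrix (a × b × c) (a × b × c) ℂ) :
    Matrix (a × c) (a × c) ℂ :=
  Matrix.of fun p q => ∑ j : b, M (p.1, j, p.2) (q.1, j, q.2)

/-- Partial trace over the last of three systems. -/
def traceThird {a b c : Type*} [Fintype c] (M : Matrix (a × b × c) (a × b × c) ℂ) :
    Matrix (a × b) (a × b) ℂ :=
  Matrix.of fun p q => ∑ j : c, M (p.1, p.2, j) (q.1, q.2, j)

/-- Partial trace over the third of four systems. -/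
def traceThirdOfFour {a b c d : Type*} [Fintype c]
    (M : Matrix (a × b × c × d) (a × b × c × d) ℂ) : Matrix (a × b × d) (a × b × d) ℂ :=
  Matrix.of fun p q => ∑ j : c, M (p.1, p.2.1, j, p.2.2) (q.1, q.2.1, j, q.2.2)

/-- Partial trace over the last of four systems. -/
def traceFourthOfFour {a b c d : Type*} [Fintype d]
    (M : Matrix (a × b × c × d) (a × b × c × d) ℂ) : Matrix (a × b × c) (a × b × c) ℂ :=
  Matrix.of fun p q => ∑ j : d, M (p.1, p.2.1, p.2.2, j) (q.1, q.2.1, q.2.2, j)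

/-- The min-entropy `H_min(A|B)_ρ`: the supremum of the real numbers `l` such that
`ρ ≤ 2^(-l) 𝟙_A ⊗ σ_B` for some state `σ_B`. -/
def hMin {a b : Type*} [Fintype a] [DecidableEq a] [Fintype b]
    (ρ : Matrix (a × b) (a × b) ℂ) : EReal :=
  sSup {x : EReal | ∃ (l : ℝ) (σ : Matrix b b ℂ), IsState σ ∧
    ρ ≤ ((2 : ℝ) ^ (-l)) • ((1 : Matrix a a ℂ) ⊗ₖ σ) ∧ x = (l : EReal)}

/-- The vector `∑ (√ρ)_{(i,j),k} |i⟩|j⟩|k⟩` on `A ⊗ B ⊗ C`, where `C` is a copy of `A ⊗ B`. -/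
def purificationVec {a b : Type*} [Fintype a] [DecidableEq a] [Fintype b] [DecidableEq b]
    (ρ : Matrix (a × b) (a × b) ℂ) : a × b × (a × b) → ℂ :=
  fun p => CFC.sqrt ρ (p.1, p.2.1) p.2.2

/-- The canonical purification of `ρ_AB`, the pure state `|ψ⟩⟨ψ|` on `A ⊗ B ⊗ C` with
`|ψ⟩ = purificationVec ρ`. -/
def purification {a b : Type*} [Fintype a] [DecidableEq a] [Fintype b] [DecidableEq b]
    (ρ : Matrix (a × b) (a × b) ℂ) : Matrix (a × b × (a × b)) (a × b × (a × b)) ℂ :=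
  Matrix.vecMulVec (purificationVec ρ) (star (purificationVec ρ))

/-- The canonical purification is a purification. -/
theorem traceThird_purification {a b : Type*} [Fintype a] [DecidableEq a] [Fintype b]
    [DecidableEq b] {ρ : Matrix (a × b) (a × b) ℂ} (hρ : ρ.PosSemidef) :
    traceThird (purification ρ) = ρ := by
  have h1 : CFC.sqrt ρ * (CFC.sqrt ρ)ᴴ = ρ := by
    rw [(Matrix.nonneg_iff_posSemidef.mp (CFC.sqrt_nonneg ρ)).isHermitian.eq]
    exact CFC.sqrt_mul_sqrt_self ρ hρ.nonneg
  conv_rhs => rw [← h1]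
  ext p q
  simp [traceThird, purification, purificationVec, Matrix.vecMulVec_apply, Matrix.mul_apply]

/-- The max-entropy `H_max(A|B)_ρ = -H_min(A|C)`, where `ρ_ABC` is a purification of `ρ_AB`. -/
def hMax {a b : Type*} [Fintype a] [DecidableEq a] [Fintype b] [DecidableEq b]
    (ρ : Matrix (a × b) (a × b) ℂ) : EReal :=
  -hMin (traceSecond (purification ρ))

/-- The smooth min-entropy `H_min^ε(A|B)_ρ`, optimised over the sub-normalised states in the
`ε`-ball of the purified distance around `ρ`. -/
def hMinSmooth {a b : Type*} [Fintype a] [DecidableEq a] [Fintype b] [DecidableEq b]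
    (ε : ℝ) (ρ : Matrix (a × b) (a × b) ℂ) : EReal :=
  sSup {x : EReal | ∃ ρ' : Matrix (a × b) (a × b) ℂ,
    IsSubState ρ' ∧ purifiedDistance ρ ρ' ≤ ε ∧ x = hMin ρ'}

/-- The smooth max-entropy `H_max^ε(A|B)_ρ`. -/
def hMaxSmooth {a b : Type*} [Fintype a] [DecidableEq a] [Fintype b] [DecidableEq b]
    (ε : ℝ) (ρ : Matrix (a × b) (a × b) ℂ) : EReal :=
  sInf {x : EReal | ∃ ρ' : Matrix (a × b) (a × b) ℂ,
    IsSubState ρ' ∧ purifiedDistance ρ ρ' ≤ ε ∧ x = hMax ρ'}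

/-- A family of general measurements on a system `a`, one for each basis label `α : t`: operators
`F α y` with `∑ y, (F α y)† (F α y) = 𝟙`. -/
def IsMeasurementFamily {t y a : Type*} [Fintype y] [Fintype a] [DecidableEq a]
    (F : t → y → Matrix a a ℂ) : Prop :=
  ∀ α, ∑ i, (F α i)ᴴ * F α i = 1

/-- The Kraus operator `|α⟩⟨α|_θ ⊗ F^{v(α),i}_A ⊗ 𝟙_R`. -/
def measureKraus {t y a r : Type*} [DecidableEq t] [DecidableEq r]
    (F : t → y → Matrix a a ℂ) (v : t → t) (α : t) (i : y) :
    Matrix (t × a × r) (t × a × r) ℂ :=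
  Matrix.single α α (1 : ℂ) ⊗ₖ (F (v α) i ⊗ₖ (1 : Matrix r r ℂ))

/-- The measurement map `M_{v(θ) A → Y}`: system `A` is measured in the basis `v(θ)`, where `θ` is
read from the basis register, the outcome is written to a new register `Y`, and `A` is traced out:
`ρ ↦ Tr_A [∑_{α,i} |i⟩⟨i|_Y ⊗ K_{α,i} ρ K_{α,i}†]` with `K_{α,i} = |α⟩⟨α|_θ ⊗ F^{v(α),i}_A ⊗ 𝟙_R`. -/
def measurementMap {t y a r : Type*} [Fintype t] [DecidableEq t] [Fintype y] [DecidableEq y]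
    [Fintype a] [Fintype r] [DecidableEq r]
    (F : t → y → Matrix a a ℂ) (v : t → t) (ρ : Matrix (t × a × r) (t × a × r) ℂ) :
    Matrix (y × t × r) (y × t × r) ℂ :=
  traceThirdOfFour (∑ α, ∑ i, Matrix.single i i (1 : ℂ) ⊗ₖ
    (measureKraus F v α i * ρ * (measureKraus F v α i)ᴴ))

/-- The overlap `c_q = max_α max_{i,j} ‖F^{α,i} (F^{v(α),j})†‖²`. -/
def overlap {t y a : Type*} [Fintype a] [DecidableEq a]
    (F : t → y → Matrix a a ℂ) (v : t → t) : ℝ :=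
  ⨆ p : t × y × y, opNorm (F p.1 p.2.1 * (F (v p.1) p.2.2)ᴴ) ^ 2

end QEntropy

end

/-!
Every state is written as `R * Rᴴ`, so that `R` is the matrix of a purification whose environment
is the column index of `R`. For states centred at trace one the generalised fidelity is
`‖√ρ √σ‖₁²`, and Uhlmann's theorem becomes a statement on matrices: `Re Tr (Xᴴ Z)` is at most the
root fidelity of `X * Xᴴ` and `Z * Zᴴ` (`trace_conjTranspose_mul_re_le_traceNorm`), and equality is
reached after acting on the environment of one of them by a contraction
(`exists_contraction_trace_eq_traceNorm`). Contractions may decrease the trace, which is harmless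
because smoothing ranges over sub-normalised states.

Let `ρ = R * Rᴴ`. Measuring the second family `G α = F (v α)` gives the state of `Y θ B` with
purification `purifyBob G R`, where the environment keeps copies of `Y` and `θ`; measuring `F`
gives the state of `Y θ E` with purification `purifyEve F R`. Both `purifyBob G` and `purifyEve F`
are isometries in `R`. Given `ω` close to the state of `Y θ B`, Uhlmann's theorem supplies a
purification `√ω * W` as close to `purifyBob G R`. Undoing the measurement by the adjoint
`unmeasureBob G` of the isometry and measuring `F` instead gives a state `τ` of `Y θ E`, which is
at least as close to the true one.

It remains to bound `H_min` of `τ`. By duality `-H_max(ω)` is the min-entropy of `Y` given the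
environment of `√ω`, so a value `l` in its defining set means `ω_YC ≤ 2^(-l) 𝟙 ⊗ σ`. The passage
from `√ω * W` to `τ` consists of the operators `F α j * (G α i)ᴴ` and partial traces; since
`(F α j * (G α i)ᴴ)ᴴ * (F α j * (G α i)ᴴ) ≤ c_q 𝟙`, the right-hand side is mapped below
`2^(-l) c_q 𝟙 ⊗ σ'` with `Tr σ' ≤ 1` (`purifyEve_unmeasureBob_le`). Hence
`H_min(τ) ≥ l + log₂ (1 / c_q)`, and the supremum over `l` and the infimum over `ω` give the
theorem. The register `θ` is only read and copied, so for each label `α` this is the uncertainty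
relation for the pair of measurements `F α` and `F (v α)`.
-/

namespace QEntropy

open scoped Matrix Kronecker ComplexOrder MatrixOrder

/-! ### Contractions, polar decomposition and Uhlmann's theorem -/

section Contractions

open scoped Matrix.Norms.L2Operator

variable {m n r : Type*} [Fintype m] [Fintype n] [DecidableEq n]
  [Fintype r]

theorem sum_norm_mulVec_sq_le (A : Matrix m n ℂ) (x : n → ℂ) :
    ∑ i, ‖(A *ᵥ x) i‖ ^ 2 ≤ ‖A‖ ^ 2 * ∑ j, ‖x j‖ ^ 2 := by
  have h := Matrix.l2_opNorm_mulVec A (WithLp.toLp 2 x)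
  have h2 := pow_le_pow_left₀ (norm_nonneg _) h 2
  rw [mul_pow, EuclideanSpace.norm_sq_eq, EuclideanSpace.norm_sq_eq] at h2
  simpa using h2

theorem conjTranspose_mul_self_le_one {V : Matrix m n ℂ} (hV : ‖V‖ ≤ 1) : Vᴴ * V ≤ 1 := by
  have h0 : 0 ≤ Vᴴ * V := (Matrix.posSemidef_conjTranspose_mul_self V).nonneg
  rw [← CStarAlgebra.norm_le_one_iff_of_nonneg _ h0, Matrix.l2_opNorm_conjTranspose_mul_self]
  exact mul_le_one₀ hV (norm_nonneg _) hV

theorem norm_le_one_of_conjTranspose_mul_self_le_one {V : Matrix m n ℂ} (hV : Vᴴ * V ≤ 1) :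
    ‖V‖ ≤ 1 := by
  have h0 : 0 ≤ Vᴴ * V := (Matrix.posSemidef_conjTranspose_mul_self V).nonneg
  rw [← CStarAlgebra.norm_le_one_iff_of_nonneg _ h0, Matrix.l2_opNorm_conjTranspose_mul_self] at hV
  nlinarith [norm_nonneg V]

theorem norm_mul_le_one [DecidableEq r] {V : Matrix m n ℂ} {W : Matrix n r ℂ}
    (hV : ‖V‖ ≤ 1) (hW : ‖W‖ ≤ 1) :
    ‖V * W‖ ≤ 1 :=
  (Matrix.l2_opNorm_mul V W).trans (mul_le_one₀ hV (norm_nonneg _) hW)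

theorem trace_mul_re_nonneg {A B : Matrix n n ℂ} (hA : A.PosSemidef) (hB : B.PosSemidef) :
    0 ≤ (A * B).trace.re := by
  obtain ⟨S, rfl⟩ := CStarAlgebra.nonneg_iff_eq_star_mul_self.mp hA.nonneg
  rw [Matrix.mul_assoc, Matrix.trace_mul_comm]
  have := (hB.mul_mul_conjTranspose_same S).trace_nonneg
  exact (Complex.le_def.mp this).1

theorem trace_mul_contraction_re_le {R K : Matrix n n ℂ} (hR : R.PosSemidef) (hK : ‖K‖ ≤ 1) :
    (R * K).trace.re ≤ R.trace.re := by
  -- the real part of a contraction is at most `1`: `2 - K - Kᴴ = (1 - Kᴴ K) + (1 - K)ᴴ (1 - K)`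
  have h1 : (1 - Kᴴ * K).PosSemidef :=
    Matrix.le_iff.mp (conjTranspose_mul_self_le_one hK)
  have h2 := Matrix.posSemidef_conjTranspose_mul_self (1 - K)
  have h3 := trace_mul_re_nonneg hR (h1.add h2)
  have h4 : (R * Kᴴ).trace.re = (R * K).trace.re := by
    have : (R * Kᴴ).trace = star (R * K).trace := by
      rw [← Matrix.trace_conjTranspose, Matrix.conjTranspose_mul, hR.isHermitian.eq,
        Matrix.trace_mul_comm]
    rw [this]; simp
  have h5 : (1 - Kᴴ * K) + (1 - K)ᴴ * (1 - K) = 1 + 1 - K - Kᴴ := by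
    simp only [Matrix.conjTranspose_sub, Matrix.conjTranspose_one]; noncomm_ring
  rw [h5] at h3
  simp only [mul_sub, mul_add, mul_one, Matrix.trace_sub, Matrix.trace_add, Complex.sub_re,
    Complex.add_re, h4] at h3
  linarith

theorem trace_mul_mul_conjTranspose_re_le [DecidableEq m] {R : Matrix m m ℂ} (hR : R.PosSemidef)
    {W : Matrix m n ℂ} (hW : ‖W‖ ≤ 1) : (R * (W * Wᴴ)).trace.re ≤ R.trace.re :=
  trace_mul_contraction_re_le hR
    (norm_mul_le_one hW ((Matrix.l2_opNorm_conjTranspose W).trans_le hW))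

/-- A positive semidefinite `H` has an inverse square root on its support: here `√x` is inverted
by `(√x)⁻¹`, with `0⁻¹ = 0` on the kernel. -/
theorem exists_inv_sqrt_on_support {H : Matrix n n ℂ} (h0 : 0 ≤ H) :
    ∃ B : Matrix n n ℂ, Bᴴ = B ∧ B * H = CFC.sqrt H ∧ B * H * B ≤ 1 ∧
      H * (B * CFC.sqrt H) = H := by
  have hsa : IsSelfAdjoint H := h0.isSelfAdjoint
  have hc : ∀ f : ℝ → ℝ, ContinuousOn f (spectrum ℝ H) := fun f =>
    (Matrix.finite_real_spectrum (A := H)).continuousOn f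
  have hsqrt : CFC.sqrt H = cfc Real.sqrt H := by
    rw [CFC.sqrt_eq_real_sqrt _ h0, cfcₙ_eq_cfc]
  have hpos : ∀ x ∈ spectrum ℝ H, 0 ≤ x := fun x hx => spectrum_nonneg_of_nonneg h0 hx
  set f : ℝ → ℝ := fun x => (Real.sqrt x)⁻¹ with hf
  have hid : H = cfc (fun x : ℝ => x) H := (cfc_id' ℝ _ hsa).symm
  have e1 : cfc f H * H = cfc Real.sqrt H := by
    nth_rewrite 2 [hid]
    rw [← cfc_mul f _ _ (hc _) (hc _)]
    refine cfc_congr fun x hx => ?_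
    rcases (hpos x hx).eq_or_lt with h | h
    · simp [← h]
    · have := Real.sqrt_pos.mpr h
      simp only [hf]
      rw [inv_mul_eq_iff_eq_mul₀ this.ne', Real.mul_self_sqrt h.le]
  refine ⟨cfc f H, (cfc_predicate f H : IsSelfAdjoint _), by rw [e1, hsqrt], ?_, ?_⟩
  · rw [e1, ← cfc_mul _ _ _ (hc _) (hc _)]
    refine cfc_le_one _ _ fun x _ => ?_
    exact mul_inv_le_one
  · rw [hsqrt, ← cfc_mul _ _ _ (hc _) (hc _)]
    nth_rewrite 1 [hid]
    rw [← cfc_mul _ _ _ (hc _) (hc _)]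
    conv_rhs => rw [hid]
    refine cfc_congr fun x hx => ?_
    rcases (hpos x hx).eq_or_lt with h | h
    · simp [← h]
    · have := Real.sqrt_pos.mpr h
      simp [hf, this.ne']

/-- Polar decomposition of a rectangular matrix, with a contraction in place of the partial
isometry. -/
theorem exists_polar (N : Matrix m n ℂ) :
    ∃ V : Matrix m n ℂ, ‖V‖ ≤ 1 ∧ N = V * CFC.sqrt (Nᴴ * N) ∧ Vᴴ * N = CFC.sqrt (Nᴴ * N) := by
  obtain ⟨B, hBh, h1, h2, h3⟩ :=
    exists_inv_sqrt_on_support (Matrix.posSemidef_conjTranspose_mul_self N).nonneg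
  refine ⟨N * B, ?_, ?_, ?_⟩
  · apply norm_le_one_of_conjTranspose_mul_self_le_one
    rw [Matrix.conjTranspose_mul, hBh]
    simpa only [Matrix.mul_assoc] using h2
  · have h4 : N * (1 - B * CFC.sqrt (Nᴴ * N)) = 0 := by
      rw [← Matrix.conjTranspose_mul_self_eq_zero, Matrix.conjTranspose_mul, Matrix.mul_assoc,
        ← Matrix.mul_assoc Nᴴ, mul_sub, h3, mul_one, sub_self, Matrix.mul_zero]
    rw [Matrix.mul_sub, Matrix.mul_one, sub_eq_zero] at h4
    rw [Matrix.mul_assoc, ← h4]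
  · rw [Matrix.conjTranspose_mul, hBh, Matrix.mul_assoc, h1]

theorem traceNorm_nonneg (N : Matrix n n ℂ) : 0 ≤ traceNorm N :=
  (Complex.le_def.mp
    (Matrix.nonneg_iff_posSemidef.mp (CFC.sqrt_nonneg (Nᴴ * N))).trace_nonneg).1

/-- The trace norm dominates pairings with contractions; equality is attained at the adjoint of the
polar factor of `N`. -/
theorem trace_mul_contraction_re_le_traceNorm (N : Matrix n n ℂ) {K : Matrix n n ℂ}
    (hK : ‖K‖ ≤ 1) : (N * K).trace.re ≤ traceNorm N := by
  obtain ⟨V, hV, hN, -⟩ := exists_polar N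
  have h := trace_mul_contraction_re_le
    (Matrix.nonneg_iff_posSemidef.mp (CFC.sqrt_nonneg (Nᴴ * N))) (norm_mul_le_one hK hV)
  rw [← Matrix.mul_assoc, Matrix.trace_mul_comm, ← Matrix.mul_assoc, ← hN] at h
  exact h

/-- Any factorisation `σ = X Xᴴ` differs from `√σ` by a contraction, in both directions. -/
theorem exists_contraction_sqrt (X : Matrix n r ℂ) :
    ∃ V : Matrix r n ℂ, ‖V‖ ≤ 1 ∧ X = CFC.sqrt (X * Xᴴ) * Vᴴ ∧ X * V = CFC.sqrt (X * Xᴴ) := by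
  obtain ⟨V, hV, h1, h2⟩ := exists_polar Xᴴ
  rw [Matrix.conjTranspose_conjTranspose] at h1 h2
  have hs : (CFC.sqrt (X * Xᴴ))ᴴ = CFC.sqrt (X * Xᴴ) :=
    (Matrix.nonneg_iff_posSemidef.mp (CFC.sqrt_nonneg _)).isHermitian.eq
  refine ⟨V, hV, ?_, ?_⟩
  · have := congrArg Matrix.conjTranspose h1
    rwa [Matrix.conjTranspose_conjTranspose, Matrix.conjTranspose_mul, hs] at this
  · have := congrArg Matrix.conjTranspose h2
    rwa [Matrix.conjTranspose_mul, Matrix.conjTranspose_conjTranspose,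
      Matrix.conjTranspose_conjTranspose, hs] at this

/-- The easy half of Uhlmann's theorem: purifications of two states, here matrices `X` and `Z` with
the same environment `r`, overlap by at most the fidelity. -/
theorem trace_conjTranspose_mul_re_le_traceNorm [DecidableEq r] (X Z : Matrix n r ℂ) :
    (Xᴴ * Z).trace.re ≤ traceNorm (CFC.sqrt (X * Xᴴ) * CFC.sqrt (Z * Zᴴ)) := by
  obtain ⟨V, hV, hX, -⟩ := exists_contraction_sqrt X
  obtain ⟨V', hV', hZ, -⟩ := exists_contraction_sqrt Z
  have hs : (CFC.sqrt (X * Xᴴ))ᴴ = CFC.sqrt (X * Xᴴ) :=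
    (Matrix.nonneg_iff_posSemidef.mp (CFC.sqrt_nonneg _)).isHermitian.eq
  have h := trace_mul_contraction_re_le_traceNorm (CFC.sqrt (X * Xᴴ) * CFC.sqrt (Z * Zᴴ))
    (norm_mul_le_one ((Matrix.l2_opNorm_conjTranspose V').trans_le hV') hV)
  have e : Xᴴ * Z = V * (CFC.sqrt (X * Xᴴ) * CFC.sqrt (Z * Zᴴ) * V'ᴴ) := by
    conv_lhs => rw [hX, hZ]
    rw [Matrix.conjTranspose_mul, Matrix.conjTranspose_conjTranspose, hs]
    simp only [Matrix.mul_assoc]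
  rw [e, Matrix.trace_mul_comm, Matrix.mul_assoc]
  exact h

/-- The hard half of Uhlmann's theorem: acting on the environment of the purification `S` by a
contraction brings its overlap with `X` up to the fidelity. Contractions, unlike isometries, exist
between environments of any dimensions. -/
theorem exists_contraction_trace_eq_traceNorm [DecidableEq m] [DecidableEq r]
    (X : Matrix n r ℂ) (S : Matrix n m ℂ) :
    ∃ W : Matrix m r ℂ, ‖W‖ ≤ 1 ∧
      (Xᴴ * (S * W)).trace.re = traceNorm (CFC.sqrt (X * Xᴴ) * CFC.sqrt (S * Sᴴ)) := by
  obtain ⟨V, hV, -, hX⟩ := exists_contraction_sqrt X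
  obtain ⟨V', hV', -, hS⟩ := exists_contraction_sqrt S
  have hs : (CFC.sqrt (X * Xᴴ))ᴴ = CFC.sqrt (X * Xᴴ) :=
    (Matrix.nonneg_iff_posSemidef.mp (CFC.sqrt_nonneg _)).isHermitian.eq
  obtain ⟨U, hU, -, hP⟩ := exists_polar (CFC.sqrt (X * Xᴴ) * CFC.sqrt (S * Sᴴ))
  refine ⟨V' * Uᴴ * Vᴴ, norm_mul_le_one (norm_mul_le_one hV'
    ((Matrix.l2_opNorm_conjTranspose U).trans_le hU))
    ((Matrix.l2_opNorm_conjTranspose V).trans_le hV), ?_⟩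
  have e : (Xᴴ * (S * (V' * Uᴴ * Vᴴ))).trace =
      (Uᴴ * ((X * V)ᴴ * (S * V'))).trace := by
    rw [show Xᴴ * (S * (V' * Uᴴ * Vᴴ)) = (Xᴴ * (S * V') * Uᴴ) * Vᴴ by
      simp only [Matrix.mul_assoc], Matrix.trace_mul_comm, ← Matrix.mul_assoc,
      Matrix.trace_mul_comm, Matrix.conjTranspose_mul]
    simp only [Matrix.mul_assoc]
  rw [e, hX, hS, hs, hP]
  rfl

end Contractions

/-! ### States in factorised form -/

section Factorisations

variable {n r s ℓ : Type*} [Fintype n] [Fintype r] [Fintype s] [Fintype ℓ] [DecidableEq ℓ]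

theorem trace_conjTranspose_mul_eq_sum (X Z : Matrix n r ℂ) :
    (Xᴴ * Z).trace = ∑ i, ∑ k, star (X i k) * Z i k := by
  rw [Finset.sum_comm]
  simp [Matrix.trace, Matrix.mul_apply]

theorem trace_conjTranspose_mul_re_le (X Z : Matrix n r ℂ) :
    2 * (Xᴴ * Z).trace.re ≤ (Xᴴ * X).trace.re + (Zᴴ * Z).trace.re := by
  have h := (Complex.le_def.mp (Matrix.posSemidef_conjTranspose_mul_self (X - Z)).trace_nonneg).1
  have e : (Zᴴ * X).trace.re = (Xᴴ * Z).trace.re := by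
    rw [show Zᴴ * X = (Xᴴ * Z)ᴴ by simp, Matrix.trace_conjTranspose]
    simp
  simp only [Matrix.conjTranspose_sub, Matrix.sub_mul, Matrix.mul_sub, Matrix.trace_sub,
    Complex.sub_re, e, Complex.zero_re] at h
  linarith

theorem dotProduct_mul_conjTranspose_mulVec (Z : Matrix n r ℂ) (w : n → ℂ) :
    star w ⬝ᵥ (Z * Zᴴ) *ᵥ w = ((∑ k, ‖(star w ᵥ* Z) k‖ ^ 2 : ℝ) : ℂ) := by
  rw [← Matrix.mulVec_mulVec, Matrix.dotProduct_mulVec]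
  have : Zᴴ *ᵥ w = star (star w ᵥ* Z) := by
    rw [Matrix.star_vecMul, star_star]
  rw [this]
  push_cast
  simp [dotProduct, ← Complex.mul_conj']

/-- The Loewner order between factorised positive operators, as an inequality of quadratic
forms. -/
theorem mul_conjTranspose_le_smul_iff (Z : Matrix n r ℂ) (N : Matrix n s ℂ) (κ : ℝ) :
    Z * Zᴴ ≤ κ • (N * Nᴴ) ↔
      ∀ w : n → ℂ, ∑ k, ‖(w ᵥ* Z) k‖ ^ 2 ≤ κ * ∑ k, ‖(w ᵥ* N) k‖ ^ 2 := by
  have hh : (κ • (N * Nᴴ) - Z * Zᴴ).IsHermitian := by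
    refine Matrix.IsHermitian.sub ?_ (Matrix.isHermitian_mul_conjTranspose_self Z)
    rw [Matrix.IsHermitian, Matrix.conjTranspose_smul, star_trivial,
      (Matrix.isHermitian_mul_conjTranspose_self N).eq]
  have hq : ∀ w : n → ℂ, star w ⬝ᵥ (κ • (N * Nᴴ) - Z * Zᴴ) *ᵥ w =
      ((κ * ∑ k, ‖(star w ᵥ* N) k‖ ^ 2 - ∑ k, ‖(star w ᵥ* Z) k‖ ^ 2 : ℝ) : ℂ) := by
    intro w
    rw [Matrix.sub_mulVec, Matrix.smul_mulVec, dotProduct_sub, dotProduct_smul,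
      dotProduct_mul_conjTranspose_mulVec, dotProduct_mul_conjTranspose_mulVec]
    push_cast
    simp
  rw [Matrix.le_iff, Matrix.posSemidef_iff_dotProduct_mulVec]
  constructor
  · rintro ⟨-, h⟩ w
    have := h (star w)
    rw [hq, star_star, Complex.zero_le_real] at this
    linarith
  · intro h
    refine ⟨hh, fun w => ?_⟩
    rw [hq, Complex.zero_le_real]
    linarith [h (star w)]

/-- The matrix `M` with a label `g i` of its row index recorded in an extra environment register.
Passing from `M * Mᴴ` to `label g M * (label g M)ᴴ` deletes the entries between rows of different
labels, so this purifies a state whose label is classical. -/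
def label (g : n → ℓ) (M : Matrix n r ℂ) : Matrix n (ℓ × r) ℂ :=
  Matrix.of fun i k => if g i = k.1 then M i k.2 else 0

omit [Fintype n] [Fintype r] [Fintype ℓ] in
theorem label_apply (g : n → ℓ) (M : Matrix n r ℂ) (i : n) (k : ℓ × r) :
    label g M i k = if g i = k.1 then M i k.2 else 0 := rfl

theorem trace_conjTranspose_label_mul (g : n → ℓ) (M : Matrix n r ℂ) (Z : Matrix n (ℓ × r) ℂ) :
    ((label g M)ᴴ * Z).trace = (Mᴴ * Matrix.of fun i k => Z i (g i, k)).trace := by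
  simp only [trace_conjTranspose_mul_eq_sum, label_apply, Fintype.sum_prod_type, Matrix.of_apply]
  refine Finset.sum_congr rfl fun i _ => ?_
  rw [Finset.sum_eq_single (g i)]
  · simp
  · intro l _ hl
    simp [hl.symm]
  · simp

theorem trace_conjTranspose_label_mul_label (g : n → ℓ) (M M' : Matrix n r ℂ) :
    ((label g M)ᴴ * label g M').trace = (Mᴴ * M').trace := by
  rw [trace_conjTranspose_label_mul]
  simp only [label_apply, if_true]
  rfl

omit [Fintype n] in
theorem label_mul_conjTranspose_apply (g : n → ℓ) (M : Matrix n r ℂ) (i j : n) :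
    (label g M * (label g M)ᴴ) i j =
      if g i = g j then ∑ k, M i k * star (M j k) else 0 := by
  simp only [Matrix.mul_apply, Matrix.conjTranspose_apply, label_apply, Fintype.sum_prod_type]
  rw [Finset.sum_eq_single (g i)]
  · by_cases h : g i = g j
    · simp [h]
    · simp [h, Ne.symm h]
  · intro l _ hl
    simp [hl.symm]
  · simp

end Factorisations

/-! ### Purifications of the measured states -/

section Measurement

variable {t y a b e p r : Type*} [Fintype t] [Fintype y] [Fintype a] [Fintype b] [Fintype e]
  [Fintype p]

omit [Fintype t] in
theorem IsMeasurementFamily.sum_dotProduct [DecidableEq a] {F : t → y → Matrix a a ℂ}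
    (hF : IsMeasurementFamily F) (α : t) (q q' : a → ℂ) :
    ∑ j, star (F α j *ᵥ q) ⬝ᵥ (F α j *ᵥ q') = star q ⬝ᵥ q' := by
  have h : ∀ j, star (F α j *ᵥ q) ⬝ᵥ (F α j *ᵥ q') = star q ⬝ᵥ ((F α j)ᴴ * F α j) *ᵥ q' := by
    intro j
    rw [Matrix.star_mulVec, ← Matrix.mulVec_mulVec, Matrix.dotProduct_mulVec,
      Matrix.dotProduct_mulVec, ← Matrix.dotProduct_mulVec]
  simp_rw [h]
  rw [← dotProduct_sum, ← Matrix.sum_mulVec, hF α, Matrix.one_mulVec]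

theorem trace_conjTranspose_eq_sum_dotProduct (R R' : Matrix (t × a × b × e) p ℂ) :
    (Rᴴ * R').trace = ∑ α, ∑ β, ∑ ε, ∑ k,
      (star fun x => R (α, x, β, ε) k) ⬝ᵥ (fun x => R' (α, x, β, ε) k) := by
  rw [trace_conjTranspose_mul_eq_sum]
  simp only [Fintype.sum_prod_type, dotProduct, Pi.star_apply]
  refine Finset.sum_congr rfl fun α _ => ?_
  rw [Finset.sum_comm]
  refine Finset.sum_congr rfl fun β _ => ?_
  rw [Finset.sum_comm]
  refine Finset.sum_congr rfl fun ε _ => ?_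
  rw [Finset.sum_comm]

theorem sum_reorder {ι₁ ι₂ ι₃ ι₄ ι₅ : Type*} [Fintype ι₁] [Fintype ι₂] [Fintype ι₃] [Fintype ι₄]
    [Fintype ι₅] (f : ι₁ → ι₂ → ι₃ → ι₄ → ι₅ → ℂ) :
    ∑ i₁, ∑ i₂, ∑ i₃, ∑ i₄, ∑ i₅, f i₁ i₂ i₃ i₄ i₅ =
      ∑ i₂, ∑ i₄, ∑ i₅, ∑ i₁, ∑ i₃, f i₁ i₂ i₃ i₄ i₅ := by
  have h := Fintype.sum_equiv
    { toFun := fun q : ι₁ × ι₂ × ι₃ × ι₄ × ι₅ =>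
        (q.2.1, q.2.2.2.1, q.2.2.2.2, q.1, q.2.2.1)
      invFun := fun q : ι₂ × ι₄ × ι₅ × ι₁ × ι₃ =>
        (q.2.2.2.1, q.1, q.2.2.2.2, q.2.1, q.2.2.1) }
    (fun q => f q.1 q.2.1 q.2.2.1 q.2.2.2.1 q.2.2.2.2)
    (fun q => f q.2.2.2.1 q.1 q.2.2.2.2 q.2.1 q.2.2.1) fun _ => rfl
  simpa only [Fintype.sum_prod_type] using h

variable [DecidableEq t] [DecidableEq y]

/-- Purification of the state of `Y θ B` after the measurement of `θ A` in `R * Rᴴ`; the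
environment holds copies of `Y` and `θ`, and `A`, `E` and the purifying system of `R`. -/
def purifyBob (G : t → y → Matrix a a ℂ) (R : Matrix (t × a × b × e) p ℂ) :
    Matrix (y × t × b) ((y × t) × a × e × p) ℂ :=
  label (fun i => (i.1, i.2.1)) (Matrix.of fun i k =>
    (G i.2.1 i.1 *ᵥ fun x => R (i.2.1, x, i.2.2, k.2.1) k.2.2) k.1)

/-- Purification of the state of `Y θ E` after the measurement of `θ A` in `R * Rᴴ`; the
environment holds copies of `Y` and `θ`, and `A`, `B` and the purifying system of `R`. -/
def purifyEve (F : t → y → Matrix a a ℂ) (R : Matrix (t × a × b × e) p ℂ) :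
    Matrix (y × t × e) ((y × t) × a × b × p) ℂ :=
  label (fun i => (i.1, i.2.1)) (Matrix.of fun i k =>
    (F i.2.1 i.1 *ᵥ fun x => R (i.2.1, x, k.2.1, i.2.2) k.2.2) k.1)

/-- The adjoint of the isometry `R ↦ purifyBob G R`; it undoes the measurement. -/
def unmeasureBob (G : t → y → Matrix a a ℂ)
    (Z : Matrix (y × t × b) ((y × t) × a × e × p) ℂ) : Matrix (t × a × b × e) p ℂ :=
  Matrix.of fun i k =>
    (∑ j, (G i.1 j)ᴴ *ᵥ fun x => Z (j, i.1, i.2.2.1) ((j, i.1), x, i.2.2.2, k)) i.2.1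

/-- `purifyEve F` is an isometry. -/
theorem trace_purifyEve [DecidableEq a] {F : t → y → Matrix a a ℂ} (hF : IsMeasurementFamily F)
    (R R' : Matrix (t × a × b × e) p ℂ) :
    ((purifyEve F R)ᴴ * purifyEve F R').trace = (Rᴴ * R').trace := by
  rw [purifyEve, purifyEve, trace_conjTranspose_label_mul_label, trace_conjTranspose_mul_eq_sum,
    trace_conjTranspose_eq_sum_dotProduct R R']
  simp only [Fintype.sum_prod_type, Matrix.of_apply]
  rw [Finset.sum_comm]
  refine Finset.sum_congr rfl fun α _ => ?_
  rw [sum_reorder, Finset.sum_comm]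
  refine Finset.sum_congr rfl fun β _ => Finset.sum_congr rfl fun ε _ =>
    Finset.sum_congr rfl fun k _ => ?_
  exact hF.sum_dotProduct α _ _

/-- `purifyBob G` is an isometry. -/
theorem trace_purifyBob [DecidableEq a] {G : t → y → Matrix a a ℂ} (hG : IsMeasurementFamily G)
    (R R' : Matrix (t × a × b × e) p ℂ) :
    ((purifyBob G R)ᴴ * purifyBob G R').trace = (Rᴴ * R').trace := by
  rw [purifyBob, purifyBob, trace_conjTranspose_label_mul_label, trace_conjTranspose_mul_eq_sum,
    trace_conjTranspose_eq_sum_dotProduct R R']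
  simp only [Fintype.sum_prod_type, Matrix.of_apply]
  rw [Finset.sum_comm]
  refine Finset.sum_congr rfl fun α _ => ?_
  rw [sum_reorder]
  refine Finset.sum_congr rfl fun β _ => Finset.sum_congr rfl fun ε _ =>
    Finset.sum_congr rfl fun k _ => ?_
  exact hG.sum_dotProduct α _ _

theorem trace_conjTranspose_mul_unmeasureBob (G : t → y → Matrix a a ℂ)
    (R : Matrix (t × a × b × e) p ℂ) (Z : Matrix (y × t × b) ((y × t) × a × e × p) ℂ) :
    (Rᴴ * unmeasureBob G Z).trace = ((purifyBob G R)ᴴ * Z).trace := by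
  rw [purifyBob, trace_conjTranspose_label_mul, trace_conjTranspose_mul_eq_sum (Matrix.of _),
    trace_conjTranspose_eq_sum_dotProduct R]
  simp only [Fintype.sum_prod_type, Matrix.of_apply]
  rw [Finset.sum_comm (s := (Finset.univ : Finset y))]
  refine Finset.sum_congr rfl fun α _ => ?_
  rw [sum_reorder]
  refine Finset.sum_congr rfl fun β _ => Finset.sum_congr rfl fun ε _ =>
    Finset.sum_congr rfl fun k _ => ?_
  trans star (fun x => R (α, x, β, ε) k) ⬝ᵥ
    ∑ j, (G α j)ᴴ *ᵥ fun x => Z (j, α, β) ((j, α), x, ε, k)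
  · rfl
  · rw [dotProduct_sum]
    refine Finset.sum_congr rfl fun j _ => ?_
    rw [Matrix.dotProduct_mulVec, ← Matrix.star_mulVec]
    rfl

/-- Undoing the measurement does not increase the trace of a state, being the adjoint of an
isometry. -/
theorem trace_unmeasureBob_re_le [DecidableEq a] {G : t → y → Matrix a a ℂ}
    (hG : IsMeasurementFamily G)
    (Z : Matrix (y × t × b) ((y × t) × a × e × p) ℂ) :
    ((unmeasureBob G Z)ᴴ * unmeasureBob G Z).trace.re ≤ (Zᴴ * Z).trace.re := by
  have h := trace_conjTranspose_mul_re_le (purifyBob G (unmeasureBob G Z)) Z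
  rw [← trace_conjTranspose_mul_unmeasureBob, trace_purifyBob hG] at h
  linarith

theorem measurementMap_mul_conjTranspose_apply [Fintype r] [DecidableEq r]
    (F : t → y → Matrix a a ℂ) (v : t → t)
    (R : Matrix (t × a × r) p ℂ) (i i' : y) (α α' : t) (q q' : r) :
    measurementMap F v (R * Rᴴ) (i, α, q) (i', α', q') =
      if (i, α) = (i', α') then ∑ x, ∑ k, (F (v α) i *ᵥ fun x => R (α, x, q) k) x *
        star ((F (v α) i *ᵥ fun x => R (α, x, q') k) x) else 0 := by
  have hK : ∀ (α₀ α : t) (i : y) (x : a) (q : r) (k : p), 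
      ((measureKraus F v α₀ i : Matrix (t × a × r) (t × a × r) ℂ) * R) (α, x, q) k =
      if α₀ = α then (F (v α) i *ᵥ fun x => R (α, x, q) k) x else 0 := by
    intro α₀ α i x q k
    simp only [Matrix.mul_apply, measureKraus, Fintype.sum_prod_type, Matrix.kroneckerMap_apply,
      Matrix.single_apply, Matrix.one_apply, Matrix.mulVec, dotProduct]
    by_cases h : α₀ = α
    · subst h
      simp
    · simp [h]
  have hKK : ∀ (K : Matrix (t × a × r) (t × a × r) ℂ) (k l : t × a × r),
      (K * (R * Rᴴ) * Kᴴ) k l = ∑ m, (K * R) k m * star ((K * R) l m) := by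
    intro K k l
    rw [show K * (R * Rᴴ) * Kᴴ = (K * R) * (K * R)ᴴ by
      rw [Matrix.conjTranspose_mul]; simp only [Matrix.mul_assoc], Matrix.mul_apply]
    rfl
  simp only [measurementMap, traceThirdOfFour, Matrix.of_apply, hKK, Matrix.sum_apply,
    Matrix.kroneckerMap_apply, hK, Matrix.single_apply, Prod.mk.injEq]
  by_cases h1 : i = i'
  · subst h1
    by_cases h2 : α = α'
    · subst h2
      simp
    · simp [h2]
  · have h3 : ∀ j, ¬(j = i ∧ j = i') := fun j hj => h1 (hj.1.symm.trans hj.2)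
    simp [h1, h3]

theorem purifyEve_mul_conjTranspose [DecidableEq b] [DecidableEq e]
    (F : t → y → Matrix a a ℂ) (v : t → t) (R : Matrix (t × a × b × e) p ℂ) :
    purifyEve (fun α => F (v α)) R * (purifyEve (fun α => F (v α)) R)ᴴ =
      traceThirdOfFour (measurementMap F v (R * Rᴴ)) := by
  ext ⟨i, α, q⟩ ⟨i', α', q'⟩
  simp only [purifyEve, label_mul_conjTranspose_apply, traceThirdOfFour, Matrix.of_apply,
    measurementMap_mul_conjTranspose_apply, Fintype.sum_prod_type]
  by_cases h : (i, α) = (i', α')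
  · obtain ⟨rfl, rfl⟩ := Prod.mk.inj h
    simp only [if_true]
    exact Finset.sum_comm
  · simp [h]

theorem purifyBob_mul_conjTranspose [DecidableEq b] [DecidableEq e]
    (F : t → y → Matrix a a ℂ) (v : t → t) (R : Matrix (t × a × b × e) p ℂ) :
    purifyBob (fun α => F (v α)) R * (purifyBob (fun α => F (v α)) R)ᴴ =
      traceFourthOfFour (measurementMap F v (R * Rᴴ)) := by
  ext ⟨i, α, q⟩ ⟨i', α', q'⟩
  simp only [purifyBob, label_mul_conjTranspose_apply, traceFourthOfFour, Matrix.of_apply,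
    measurementMap_mul_conjTranspose_apply, Fintype.sum_prod_type]
  by_cases h : (i, α) = (i', α')
  · obtain ⟨rfl, rfl⟩ := Prod.mk.inj h
    simp only [if_true]
    exact Finset.sum_comm
  · simp [h]

end Measurement

/-! ### The operator inequality -/

section MinEntropy

variable {t y a b e p c s : Type*} [Fintype t] [DecidableEq t] [Fintype y] [DecidableEq y]
  [Fintype a] [DecidableEq a] [Fintype b] [Fintype e] [Fintype p] [Fintype c] [Fintype s]

/-- A factor `N` of the marginal `N * Nᴴ` on `θ E` of the state `Y * Yᴴ` on the environment of
`purifyBob`: everything but `θ` and `E` is traced out, that is, moved to the column index, and `θ`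
is dephased by `label`. -/
def eveMarginal (Y : Matrix ((y × t) × a × e × p) s ℂ) :
    Matrix (t × e) (t × y × a × p × s) ℂ :=
  label Prod.fst (Matrix.of fun i k => Y ((k.1, i.1), k.2.1, i.2, k.2.2.1) k.2.2.2)

/-- The heart of the uncertainty relation. Undoing the measurement `G` and measuring `F` acts on
each outcome pair by `F α j * (G α i)ᴴ`, so it maps `𝟙 ⊗ σ` below `C • (𝟙 ⊗ σ')`. Here
`σ = D * Dᴴ` is a state of the environment `c` of `S`. The contraction `W` acts on column indices,
hence as `Wᵀ` on `D`. -/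
theorem purifyEve_unmeasureBob_le {F G : t → y → Matrix a a ℂ} {C κ : ℝ} (hκ : 0 ≤ κ)
    (hC : ∀ α j i, opNorm (F α j * (G α i)ᴴ) ^ 2 ≤ C) (S : Matrix (y × t × b) c ℂ)
    (W : Matrix c ((y × t) × a × e × p) ℂ) (D : Matrix c s ℂ)
    (h : (Matrix.of fun (i : y × c) (q : t × b) => S (i.1, q) i.2) *
      (Matrix.of fun (i : y × c) (q : t × b) => S (i.1, q) i.2)ᴴ ≤
        κ • (((1 : Matrix y y ℂ) ⊗ₖ D) * ((1 : Matrix y y ℂ) ⊗ₖ D)ᴴ)) :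
    purifyEve F (unmeasureBob G (S * W)) * (purifyEve F (unmeasureBob G (S * W)))ᴴ ≤
      (κ * C) • (((1 : Matrix y y ℂ) ⊗ₖ eveMarginal (Wᵀ * D)) *
        ((1 : Matrix y y ℂ) ⊗ₖ eveMarginal (Wᵀ * D))ᴴ) := by
  rw [mul_conjTranspose_le_smul_iff] at h ⊢
  intro w
  set M : Matrix (y × c) (t × b) ℂ := Matrix.of fun i q => S (i.1, q) i.2 with hM
  -- `u j α x k` is the adjoint of the Kraus operator labelled `(j, α, x, k)`, applied to `w`
  let u : y → t → a → p → y × c → ℂ := fun j α x k i =>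
    ∑ ε, ∑ x₁, w (j, α, ε) * ((F α j * (G α i.1)ᴴ) x x₁ * W i.2 ((i.1, α), x₁, ε, k))
  -- `F α j * (G α i)ᴴ` acts on the vectors `g j α i k l` of `A`, which do not depend on `F` or `G`
  let g : y → t → y → p → s → a → ℂ := fun j α i k l x₁ =>
    ∑ ε, w (j, α, ε) * (Wᵀ * D) ((i, α), x₁, ε, k) l
  have hL : ∀ j α x β k, (w ᵥ* purifyEve F (unmeasureBob G (S * W))) ((j, α), x, β, k) =
      (u j α x k ᵥ* M) (α, β) := by
    intro j α x β k
    have h1 : ∀ ε, (F α j *ᵥ fun x' => unmeasureBob G (S * W) (α, x', β, ε) k) x =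
        ∑ i, ∑ x₁, (F α j * (G α i)ᴴ) x x₁ * (S * W) (i, α, β) ((i, α), x₁, ε, k) := by
      intro ε
      change (F α j *ᵥ ∑ i, (G α i)ᴴ *ᵥ fun x₁ => (S * W) (i, α, β) ((i, α), x₁, ε, k)) x = _
      rw [Matrix.mulVec_sum, Finset.sum_apply]
      refine Finset.sum_congr rfl fun i _ => ?_
      rw [Matrix.mulVec_mulVec]
      rfl
    have h2 : (w ᵥ* purifyEve F (unmeasureBob G (S * W))) ((j, α), x, β, k) =
        ∑ ε, w (j, α, ε) * (F α j *ᵥ fun x' => unmeasureBob G (S * W) (α, x', β, ε) k) x := by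
      simp only [Matrix.vecMul, dotProduct, Fintype.sum_prod_type, purifyEve, label_apply,
        Matrix.of_apply, Prod.mk.injEq, mul_ite, mul_zero]
      rw [Finset.sum_eq_single j (fun j' _ hj => by simp [hj]) (by simp),
        Finset.sum_eq_single α (fun α' _ hα => by simp [hα]) (by simp)]
      simp
    rw [h2]
    simp only [h1, Matrix.vecMul, dotProduct, Fintype.sum_prod_type, hM, Matrix.of_apply, u,
      Matrix.mul_apply (M := S), Finset.mul_sum, Finset.sum_mul]
    rw [Finset.sum_comm]
    refine Finset.sum_congr rfl fun i _ => ?_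
    conv_rhs => rw [Finset.sum_comm]
    refine Finset.sum_congr rfl fun ε _ => ?_
    rw [Finset.sum_comm]
    refine Finset.sum_congr rfl fun l _ => Finset.sum_congr rfl fun x₁ _ => ?_
    ring
  have hR : ∀ j α x k i l, (u j α x k ᵥ* ((1 : Matrix y y ℂ) ⊗ₖ D)) (i, l) =
      ((F α j * (G α i)ᴴ) *ᵥ g j α i k l) x := by
    intro j α x k i l
    have h1 : (u j α x k ᵥ* ((1 : Matrix y y ℂ) ⊗ₖ D)) (i, l) =
        ∑ m, u j α x k (i, m) * D m l := by
      simp only [Matrix.vecMul, dotProduct, Fintype.sum_prod_type, Matrix.kroneckerMap_apply,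
        Matrix.one_apply]
      rw [Finset.sum_eq_single i (fun i' _ hi => by simp [hi]) (by simp)]
      simp
    rw [h1]
    simp only [u, g, Matrix.mulVec, dotProduct, Matrix.mul_apply (N := D), Matrix.transpose_apply,
      Finset.mul_sum, Finset.sum_mul]
    rw [Finset.sum_comm, Finset.sum_congr rfl fun ε _ => Finset.sum_comm, Finset.sum_comm]
    refine Finset.sum_congr rfl fun x₁ _ => Finset.sum_congr rfl fun ε _ =>
      Finset.sum_congr rfl fun m _ => ?_
    ring
  have hN : ∀ j α i x₁ k l,
      (w ᵥ* ((1 : Matrix y y ℂ) ⊗ₖ eveMarginal (Wᵀ * D))) (j, α, i, x₁, k, l) =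
        g j α i k l x₁ := by
    intro j α i x₁ k l
    simp only [Matrix.vecMul, dotProduct, Fintype.sum_prod_type, Matrix.kroneckerMap_apply,
      Matrix.one_apply, eveMarginal, label_apply, Matrix.of_apply, g]
    simp [ite_mul]
  calc ∑ k, ‖(w ᵥ* purifyEve F (unmeasureBob G (S * W))) k‖ ^ 2
      = ∑ j, ∑ α, ∑ x, ∑ k, ∑ β, ‖(u j α x k ᵥ* M) (α, β)‖ ^ 2 := by
        simp only [Fintype.sum_prod_type, hL]
        refine Finset.sum_congr rfl fun j _ => Finset.sum_congr rfl fun α _ =>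
          Finset.sum_congr rfl fun x _ => Finset.sum_comm
    _ ≤ ∑ j, ∑ α, ∑ x, ∑ k, κ * ∑ i, ∑ l, ‖((F α j * (G α i)ᴴ) *ᵥ g j α i k l) x‖ ^ 2 := by
        gcongr with j _ α _ x _ k _
        have h1 := h (u j α x k)
        simp only [Fintype.sum_prod_type, hR] at h1
        refine le_trans ?_ h1
        -- only the terms whose `θ` on the `B` side agrees with the copy `α` survive in `τ`
        exact Finset.single_le_sum (f := fun α' => ∑ β, ‖(u j α x k ᵥ* M) (α', β)‖ ^ 2)
          (fun α' _ => Finset.sum_nonneg fun β _ => sq_nonneg _) (Finset.mem_univ α)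
    _ = κ * ∑ j, ∑ α, ∑ i, ∑ k, ∑ l, ∑ x, ‖((F α j * (G α i)ᴴ) *ᵥ g j α i k l) x‖ ^ 2 := by
        simp only [← Finset.mul_sum]
        congr 1
        refine Finset.sum_congr rfl fun j _ => Finset.sum_congr rfl fun α _ => ?_
        rw [Finset.sum_comm]
        conv_rhs => rw [Finset.sum_comm]
        refine Finset.sum_congr rfl fun k _ => ?_
        rw [Finset.sum_comm]
        exact Finset.sum_congr rfl fun i _ => Finset.sum_comm
    _ ≤ κ * ∑ j, ∑ α, ∑ i, ∑ k, ∑ l, C * ∑ x₁, ‖g j α i k l x₁‖ ^ 2 := by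
        gcongr with j _ α _ i _ k _ l _
        refine (sum_norm_mulVec_sq_le _ _).trans ?_
        gcongr
        exact hC α j i
    _ = κ * C * ∑ k, ‖(w ᵥ* ((1 : Matrix y y ℂ) ⊗ₖ eveMarginal (Wᵀ * D))) k‖ ^ 2 := by
        simp only [Fintype.sum_prod_type, hN, ← Finset.mul_sum, mul_assoc]
        congr 2
        refine Finset.sum_congr rfl fun j _ => Finset.sum_congr rfl fun α _ =>
          Finset.sum_congr rfl fun i _ => ?_
        conv_rhs => rw [Finset.sum_comm]
        exact Finset.sum_congr rfl fun k _ => Finset.sum_comm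

end MinEntropy

/-! ### The uncertainty relation -/

section Uncertainty

variable {t y a b e p s : Type*} [Fintype t] [DecidableEq t] [Fintype y] [DecidableEq y]
  [Fintype a] [DecidableEq a] [Fintype b] [Fintype e] [Fintype p] [Fintype s]

omit [DecidableEq y] [DecidableEq a] in
theorem trace_eveMarginal (Y : Matrix ((y × t) × a × e × p) s ℂ) :
    ((eveMarginal Y)ᴴ * eveMarginal Y).trace = (Yᴴ * Y).trace := by
  rw [eveMarginal, trace_conjTranspose_label_mul_label, trace_conjTranspose_mul_eq_sum,
    trace_conjTranspose_mul_eq_sum]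
  simp only [Fintype.sum_prod_type, Matrix.of_apply]
  rw [Finset.sum_comm (s := (Finset.univ : Finset y))]
  refine Finset.sum_congr rfl fun α _ => ?_
  rw [Finset.sum_comm]
  refine Finset.sum_congr rfl fun i _ => ?_
  rw [Finset.sum_comm]

theorem trace_transpose_mul_re_le {c k : Type*} [Fintype c] [DecidableEq c] [Fintype k]
    [DecidableEq k] {W : Matrix c k ℂ} (hW : open scoped Matrix.Norms.L2Operator in ‖W‖ ≤ 1)
    (D : Matrix c s ℂ) :
    ((Wᵀ * D)ᴴ * (Wᵀ * D)).trace.re ≤ (Dᴴ * D).trace.re := by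
  have h := trace_mul_mul_conjTranspose_re_le
    (Matrix.posSemidef_self_mul_conjTranspose D).transpose hW
  rw [Matrix.trace_transpose, Matrix.trace_mul_comm D] at h
  convert h using 2
  rw [← Matrix.trace_transpose ((D * Dᴴ)ᵀ * (W * Wᴴ)), Matrix.transpose_mul,
    Matrix.transpose_transpose, Matrix.transpose_mul, Matrix.conjTranspose_mul, Matrix.mul_assoc,
    Matrix.trace_mul_comm, Matrix.conjTranspose_transpose_eq_transpose_conjTranspose]
  simp only [Matrix.mul_assoc]

/-- The missing trace is supplied by a multiple of a pure state. -/
theorem exists_isState_ge [Nonempty s] [DecidableEq s] {σ : Matrix s s ℂ} (h : IsSubState σ) :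
    ∃ σ' : Matrix s s ℂ, IsState σ' ∧ σ ≤ σ' := by
  obtain ⟨i⟩ := ‹Nonempty s›
  have h1 : (((1 - σ.trace.re : ℝ) : ℂ) • Matrix.diagonal (Pi.single i 1 : s → ℂ)).PosSemidef := by
    refine Matrix.PosSemidef.smul (Matrix.PosSemidef.diagonal ?_) ?_
    · exact Pi.single_nonneg.mpr zero_le_one
    · exact Complex.zero_le_real.mpr (by linarith [h.2])
  refine ⟨σ + _, ⟨h.1.add h1, ?_⟩, ?_⟩
  · have h2 : (σ.trace.re : ℂ) = σ.trace := by
      have := (Complex.le_def.mp h.1.trace_nonneg).2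
      apply Complex.ext <;> simp_all
    rw [Matrix.trace_add, Matrix.trace_smul, Matrix.trace_diagonal]
    simp [h2]
  · rw [Matrix.le_iff, add_sub_cancel_left]
    exact h1

omit [Fintype t] [DecidableEq t] [DecidableEq y] in
theorem opNorm_le_overlap [Finite t] (F : t → y → Matrix a a ℂ) (v : t → t) (α : t) (j i : y) :
    opNorm (F α j * (F (v α) i)ᴴ) ^ 2 ≤ overlap F v :=
  le_ciSup (f := fun p : t × y × y => opNorm (F p.1 p.2.1 * (F (v p.1) p.2.2)ᴴ) ^ 2)
    (Set.finite_range _).bddAbove (α, j, i)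

omit [DecidableEq t] [DecidableEq y] in
/-- If all products `F α j * (F (v α) i)ᴴ` vanished, completeness of `F (v α)` would give
`F α j = 0` for all `j`, against completeness of `F α`. -/
theorem overlap_pos [Nonempty t] [Nonempty a] {F : t → y → Matrix a a ℂ}
    (hF : IsMeasurementFamily F) (v : t → t) : 0 < overlap F v := by
  obtain ⟨α⟩ := ‹Nonempty t›
  by_contra! hle
  have h0 : ∀ j i, F α j * (F (v α) i)ᴴ = 0 := by
    intro j i
    have h1 : opNorm (F α j * (F (v α) i)ᴴ) ^ 2 = 0 :=
      le_antisymm ((opNorm_le_overlap F v α j i).trans hle) (sq_nonneg _)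
    simpa [opNorm, -map_mul] using h1
  have h2 : ∀ j, F α j = 0 := by
    intro j
    rw [← mul_one (F α j), ← hF (v α), Finset.mul_sum]
    exact Finset.sum_eq_zero fun i _ => by rw [← mul_assoc, h0, zero_mul]
  have h3 := hF α
  simp only [h2, mul_zero, Finset.sum_const_zero] at h3
  exact zero_ne_one h3

theorem fidelity_eq_of_trace_eq_one {ρ σ : Matrix s s ℂ} [DecidableEq s] (hρ : ρ.trace = 1) :
    fidelity ρ σ = traceNorm (CFC.sqrt ρ * CFC.sqrt σ) ^ 2 := by
  simp [fidelity, hρ]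

theorem purifiedDistance_le {r : Type*} [Fintype r] [DecidableEq r] [DecidableEq s]
    {ρ σ : Matrix s s ℂ} {ρ' σ' : Matrix r r ℂ} (hρ : ρ.trace = 1) (hρ' : ρ'.trace = 1)
    (h : traceNorm (CFC.sqrt ρ * CFC.sqrt σ) ≤ traceNorm (CFC.sqrt ρ' * CFC.sqrt σ')) :
    purifiedDistance ρ' σ' ≤ purifiedDistance ρ σ := by
  rw [purifiedDistance, purifiedDistance, fidelity_eq_of_trace_eq_one hρ,
    fidelity_eq_of_trace_eq_one hρ']
  have := traceNorm_nonneg (CFC.sqrt ρ * CFC.sqrt σ)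
  gcongr

/-- The marginal of the canonical purification that defines the max-entropy, in factorised form. -/
theorem traceSecond_purification {c : Type*} [Fintype c] [DecidableEq c]
    (ω : Matrix (y × c) (y × c) ℂ) :
    traceSecond (purification ω) =
      (Matrix.of fun (i : y × (y × c)) (q : c) => CFC.sqrt ω (i.1, q) i.2) *
      (Matrix.of fun (i : y × (y × c)) (q : c) => CFC.sqrt ω (i.1, q) i.2)ᴴ := by
  ext i j
  simp [traceSecond, purification, purificationVec, Matrix.vecMulVec_apply, Matrix.mul_apply]

theorem one_kronecker_mul_conjTranspose {m n : Type*} [Fintype n] (N : Matrix m n ℂ) :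
    ((1 : Matrix y y ℂ) ⊗ₖ N) * ((1 : Matrix y y ℂ) ⊗ₖ N)ᴴ = 1 ⊗ₖ (N * Nᴴ) := by
  rw [Matrix.conjTranspose_kronecker, ← Matrix.mul_kronecker_mul, Matrix.conjTranspose_one,
    mul_one]

/-- The uncertainty relation for one state `ω'` near the state of `Y θ B`: it yields a state `τ'`
of `Y θ E`, at least as close to the true one, with `H_min(τ') + H_max(ω') ≥ q`. -/
theorem exists_isSubState_hMin_ge [DecidableEq b] [DecidableEq e] [DecidableEq p] [Nonempty t]
    [Nonempty a] [Nonempty e]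
    {F : t → y → Matrix a a ℂ} (hF : IsMeasurementFamily F) (v : t → t)
    (R : Matrix (t × a × b × e) p ℂ) {ω : Matrix (y × t × b) (y × t × b) ℂ} (hω : IsSubState ω) :
    ∃ τ : Matrix (y × t × e) (y × t × e) ℂ, IsSubState τ ∧
      traceNorm (CFC.sqrt (purifyBob (fun α => F (v α)) R * (purifyBob (fun α => F (v α)) R)ᴴ) *
          CFC.sqrt ω) ≤
        traceNorm (CFC.sqrt (purifyEve F R * (purifyEve F R)ᴴ) * CFC.sqrt τ) ∧
      -hMax ω + (Real.logb 2 (1 / overlap F v) : ℝ) ≤ hMin τ := by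
  set G : t → y → Matrix a a ℂ := fun α => F (v α) with hG
  have hGm : IsMeasurementFamily G := fun α => hF (v α)
  have hC := overlap_pos hF v
  set S := CFC.sqrt ω with hS
  have hSS : S * Sᴴ = ω := by
    rw [(Matrix.nonneg_iff_posSemidef.mp (CFC.sqrt_nonneg ω)).isHermitian.eq]
    exact CFC.sqrt_mul_sqrt_self ω hω.1.nonneg
  obtain ⟨W, hW, hXW⟩ := exists_contraction_trace_eq_traceNorm (purifyBob G R) S
  refine ⟨_, ⟨Matrix.posSemidef_self_mul_conjTranspose
    (purifyEve F (unmeasureBob G (S * W))), ?_⟩, ?_, ?_⟩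
  · rw [Matrix.trace_mul_comm, trace_purifyEve hF]
    refine (trace_unmeasureBob_re_le hGm _).trans ?_
    have h := trace_mul_mul_conjTranspose_re_le (Matrix.posSemidef_conjTranspose_mul_self S) hW
    rw [Matrix.trace_mul_comm Sᴴ, hSS] at h
    refine le_trans (le_of_eq ?_) (h.trans hω.2)
    rw [Matrix.conjTranspose_mul, Matrix.mul_assoc, Matrix.trace_mul_comm]
    simp only [Matrix.mul_assoc]
  · rw [hSS, ← hS] at hXW
    rw [← hXW, ← trace_conjTranspose_mul_unmeasureBob, ← trace_purifyEve hF]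
    exact trace_conjTranspose_mul_re_le_traceNorm _ _
  · rw [hMax, neg_neg, ← EReal.le_sub_iff_add_le (by simp) (by simp)]
    refine sSup_le ?_
    rintro _ ⟨l, σ, hσ, hle, rfl⟩
    rw [EReal.le_sub_iff_add_le (by simp) (by simp)]
    set D := CFC.sqrt σ with hD
    have hDD : D * Dᴴ = σ := by
      rw [(Matrix.nonneg_iff_posSemidef.mp (CFC.sqrt_nonneg σ)).isHermitian.eq]
      exact CFC.sqrt_mul_sqrt_self σ hσ.1.nonneg
    rw [traceSecond_purification, ← hDD, ← one_kronecker_mul_conjTranspose] at hle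
    have key := purifyEve_unmeasureBob_le (by positivity) (opNorm_le_overlap F v) S W D hle
    rw [one_kronecker_mul_conjTranspose] at key
    obtain ⟨σ', hσ', hle'⟩ := exists_isState_ge
      (σ := eveMarginal (Wᵀ * D) * (eveMarginal (Wᵀ * D))ᴴ)
      ⟨Matrix.posSemidef_self_mul_conjTranspose _, by
        rw [Matrix.trace_mul_comm, trace_eveMarginal]
        refine (trace_transpose_mul_re_le hW D).trans ?_
        rw [Matrix.trace_mul_comm, hDD, hσ.2, Complex.one_re]⟩
    refine le_sSup ⟨l + Real.logb 2 (1 / overlap F v), σ', hσ', ?_, by push_cast; rfl⟩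
    have hpow : (2 : ℝ) ^ (-(l + Real.logb 2 (1 / overlap F v))) = 2 ^ (-l) * overlap F v := by
      rw [neg_add, Real.rpow_add two_pos, one_div, Real.logb_inv, neg_neg,
        Real.rpow_logb two_pos (by norm_num) hC]
    rw [hpow]
    refine key.trans ?_
    have hsub : ∀ A B : Matrix (t × e) (t × e) ℂ,
        (1 : Matrix y y ℂ) ⊗ₖ A - 1 ⊗ₖ B = 1 ⊗ₖ (A - B) := by
      intro A B
      ext i j
      simp [mul_sub]
    rw [Matrix.le_iff, ← smul_sub, hsub]
    refine (Matrix.PosSemidef.kronecker Matrix.PosSemidef.one ?_).smul (by positivity)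
    exact Matrix.le_iff.mp hle'

end Uncertainty

end QEntropy

theorem mainTheorem7 {t y a b e : Type*}
    [Fintype t] [DecidableEq t] [Fintype y] [DecidableEq y] [Fintype a] [DecidableEq a]
    [Fintype b] [DecidableEq b] [Fintype e] [DecidableEq e]
    (F : t → y → Matrix a a ℂ) (hF : QEntropy.IsMeasurementFamily F)
    (v : t → t) (hv : Function.Bijective v)
    (ρ : Matrix (t × a × b × e) (t × a × b × e) ℂ) (hρ : QEntropy.IsState ρ)
    (ε : ℝ) (hε : 0 ≤ ε) :
    QEntropy.hMinSmooth ε (QEntropy.traceThirdOfFour (QEntropy.measurementMap F id ρ)) ≥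
      ((Real.logb 2 (1 / QEntropy.overlap F v) : ℝ) : EReal) -
        QEntropy.hMaxSmooth ε (QEntropy.traceFourthOfFour (QEntropy.measurementMap F v ρ)) := by
  open scoped Matrix ComplexOrder MatrixOrder in
  obtain ⟨α, x, -, z⟩ : Nonempty (t × a × b × e) := by
    by_contra hne
    rw [not_nonempty_iff] at hne
    have := hρ.2
    simp [Matrix.trace] at this
  have : Nonempty t := ⟨α⟩
  have : Nonempty a := ⟨x⟩
  have : Nonempty e := ⟨z⟩
  obtain ⟨R, hR⟩ : ∃ R : Matrix (t × a × b × e) (t × a × b × e) ℂ, R * Rᴴ = ρ := by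
    refine ⟨CFC.sqrt ρ, ?_⟩
    rw [(Matrix.nonneg_iff_posSemidef.mp (CFC.sqrt_nonneg ρ)).isHermitian.eq]
    exact CFC.sqrt_mul_sqrt_self ρ hρ.1.nonneg
  have hRtr : (Rᴴ * R).trace = 1 := by rw [Matrix.trace_mul_comm, hR, hρ.2]
  have hX := QEntropy.purifyBob_mul_conjTranspose F v R
  have hT := QEntropy.purifyEve_mul_conjTranspose F id R
  rw [hR] at hX hT
  -- as the overlap term is real, it moves across the inequality without `⊤ - ⊤` being met, and the
  -- claim reduces to a single state `ω` in the ball of the max-entropy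
  rw [ge_iff_le, sub_eq_add_neg, add_comm,
    ← EReal.le_sub_iff_add_le (by simp) (by simp), EReal.neg_le, QEntropy.hMaxSmooth]
  refine le_sInf ?_
  rintro _ ⟨ω, hω, hd, rfl⟩
  rw [EReal.neg_le, EReal.le_sub_iff_add_le (by simp) (by simp)]
  obtain ⟨τ, hτ, hfid, hmin⟩ := QEntropy.exists_isSubState_hMin_ge hF v R hω
  refine hmin.trans (le_sSup ⟨τ, hτ, le_trans ?_ hd, rfl⟩)
  rw [← hX, ← hT]
  refine QEntropy.purifiedDistance_le ?_ ?_ hfid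
  · rw [Matrix.trace_mul_comm, QEntropy.trace_purifyBob fun α => hF (v α), hRtr]
  · rw [Matrix.trace_mul_comm, QEntropy.trace_purifyEve (F := fun α => F (id α)) hF, hRtr]
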